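/- Let $d\ge 2$ be an integer, let $(p_j)_{j\ge 1}$ be real numbers in $(0,1]$, and let $(\xi_{t,j})_{t\ge 0,\,j\ge 1}$ be independent random variables with $\mathbb P(\xi_{t,j}=1)=p_j=1-\mathbb P(\xi_{t,j}=0)$. For $n\in\mathbb Z_+=\{0,1,2,\dots\}$ write $n=\sum_{j\ge1}a_j(n)d^{j-1}$ with digits $a_j(n)\in\{0,\dots,d-1\}$, and let $\zeta_n=\min\{j\ge1: a_j(n)\ne d-1\}$. The adding machine passes from $n$ to $n+1$ in $\zeta_n$ steps, the $j$-th of which adds $1$ modulo $d$ to the $j$-th digit. The $\mathrm{AMFC}_d$ (adding machine with fallible counter in base $d$) Markov chain $(X(t))_{t\ge0}$ on $\mathbb Z_+$ is obtained as follows: $X(t+1)$ is the result of applying to $n=X(t)$ only those steps $j\le\zeta_n$ with $j<\tau_t$, where $\tau_t=\inf\{j\ge1:\xi_{t,j}=0\}$ (and $\inf\emptyset=\infty$). Suppose that this chain is irreducible. Then the chain is null recurrent if and only if $$\prod_{j=1}^{\infty}p_j=0,$$ and it is transient otherwise. In particular it is never positive recurrent. Here, with $T_x=\inf\{t\ge1:X(t)=x\}$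 and $\mathbb P_x,\mathbb E_x$ referring to the chain started at $x$, the chain is transient if $\mathbb P_x(T_x<\infty)<1$ for all $x$, null recurrent if $\mathbb P_x(T_x<\infty)=1$ and $\mathbb E_x T_x=\infty$ for all $x$, and positive recurrent if $\mathbb P_x(T_x<\infty)=1$ and $\mathbb E_x T_x<\infty$ for all $x$. -/

import Mathlib

open MeasureTheory ProbabilityTheory Filter Topology
open scoped ENNReal

namespace AMFC

/-! Positions of digits, steps of the algorithm and probabilities are counted from `0`:
index `j` here is index `j + 1` in the usual notation `a₁, a₂, …`, `ξ₁, ξ₂, …`, `p₁, p₂, …`. -/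

/-- The digit of `n` at the place `d ^ j` of its expansion in base `d`. -/
def digit (d n j : ℕ) : ℕ := n / d ^ j % d

/-- The counter `ζ_n`: the number of steps the adding machine needs to pass from `n` to `n + 1`,
that is, one plus the number of trailing digits `d - 1` of `n`. -/
noncomputable def counter (d n : ℕ) : ℕ := sInf {j | digit d n j ≠ d - 1} + 1

/-- One step of the adding machine: one is added modulo `d` to the digit at the place `d ^ j`,
all other digits being kept. -/
def addOneAt (d j m : ℕ) : ℕ :=
  if digit d m j = d - 1 then m - (d - 1) * d ^ j else m + d ^ j

/-- The number obtained from `n` by the first `k` steps of the adding machine. -/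
def afterSteps (d n : ℕ) : ℕ → ℕ
  | 0 => n
  | k + 1 => addOneAt d k (afterSteps d n k)

/-- The number of steps that are performed on `n` with the successes and failures `b`:
the algorithm ends when `counter d n` steps are done, or just before the first step `k`
with `b k = false`, whichever comes first. -/
noncomputable def stepsDone (d n : ℕ) (b : ℕ → Bool) : ℕ :=
  sInf {k | k = counter d n ∨ b k = false}

/-- The outcome of the adding machine with fallible counter applied to `n`. -/
noncomputable def outcome (d n : ℕ) (b : ℕ → Bool) : ℕ := afterSteps d n (stepsDone d n b)

/-- The chain started at `x`: the fallible adding machine is applied recursively, with the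
variables `ξ t 0, ξ t 1, …` used in the passage from time `t` to time `t + 1`. -/
noncomputable def chain {Ω : Type*} (d : ℕ) (ξ : ℕ → ℕ → Ω → Bool) (x : ℕ) : ℕ → Ω → ℕ
  | 0, _ => x
  | t + 1, ω => outcome d (chain d ξ x t ω) (fun j => ξ t j ω)

section MarkovChain

/-! A Markov chain with state space `S` is given by the processes `X x`, where `X x t` is
the state at time `t` when the chain is started at `x`. -/

variable {Ω S : Type*} [MeasurableSpace Ω]

/-- Every state is reached from every state with positive probability. -/
def IsIrreducible (P : Measure Ω) (X : S → ℕ → Ω → S) : Prop :=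
  ∀ x y, ∃ t, 0 < P {ω | X x t ω = y}

/-- Probability that the chain started at `x` returns to `x` at some time `t ≥ 1`. -/
noncomputable def returnProb (P : Measure Ω) (X : S → ℕ → Ω → S) (x : S) : ℝ≥0∞ :=
  P {ω | ∃ t, 1 ≤ t ∧ X x t ω = x}

/-- The first time `t ≥ 1` at which the chain started at `x` is at `x`; it is `⊤` if there is
no such time. -/
noncomputable def returnTime (X : S → ℕ → Ω → S) (x : S) (ω : Ω) : ℕ∞ :=
  ⨅ (t : ℕ) (_ : 1 ≤ t ∧ X x t ω = x), (t : ℕ∞)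

/-- The expectation of the return time to `x`, for the chain started at `x`. -/
noncomputable def meanReturnTime (P : Measure Ω) (X : S → ℕ → Ω → S) (x : S) : ℝ≥0∞ :=
  ∫⁻ ω, (returnTime X x ω : ℝ≥0∞) ∂P

/-- All states are transient. -/
def IsTransient (P : Measure Ω) (X : S → ℕ → Ω → S) : Prop :=
  ∀ x, returnProb P X x < 1

/-- All states are null recurrent. -/
def IsNullRecurrent (P : Measure Ω) (X : S → ℕ → Ω → S) : Prop :=
  ∀ x, returnProb P X x = 1 ∧ meanReturnTime P X x = ∞

/-- All states are positive recurrent. -/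
def IsPositiveRecurrent (P : Measure Ω) (X : S → ℕ → Ω → S) : Prop :=
  ∀ x, returnProb P X x = 1 ∧ meanReturnTime P X x < ∞

end MarkovChain

/-- The infinite product of the `p j` is `0`, as the limit of the partial products. -/
def ProdEqZero (p : ℕ → ℝ) : Prop :=
  Tendsto (fun n => ∏ j ∈ Finset.range n, p j) atTop (𝓝 0)

end AMFC

/-! Let `q k` be the product of the first `k` success probabilities. Counting the states that lead
to a given state, each column of the transition matrix sums to `1`, except column `0`, whose sum is
`1 - lim q`. So counting measure is always subinvariant, and it is invariant exactly when the
product vanishes.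

The mean number of visits to a state during an excursion from `x` (`excursion`) is therefore at most
`1`. If `lim q > 0`, the return probability to `0` is at most the sum of column `0`, which is below
`1` (`passage_zero_lt_one`). If `lim q = 0`, the chain leaves `{0, …, d ^ k - 1}` only by the single
jump to `d ^ k`, which occurs with probability at most `q k` per visit to `d ^ k - 1`, so return to
`0` is certain (`one_le_passage_zero_add`). Irreducibility carries recurrence to all states
(`passage_self_eq_one`). In the recurrent case the excursion measure is counting measure
(`excursion_eq_one`), and its infinite total mass bounds the mean return time from below. -/

namespace AMFC

/-! ### Recurrence and excursion measures for a kernel on a general state space -/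

section Kernel

variable {S : Type*}

/-- If `b ≤ a` and `a` has no larger integral than `b`, then `a = b` on the support of the
weights. -/
theorem le_of_tsum_mul_le {k a b : S → ℝ≥0∞} (hk : ∑' i, k i ≠ ∞) (hb : ∑' i, k i * b i ≠ ∞)
    (hab : ∀ i, b i ≤ a i) (h : ∑' i, k i * a i ≤ ∑' i, k i * b i) {i : S} (hi : k i ≠ 0) :
    a i ≤ b i := by
  by_contra hlt
  have hki : k i ≠ ∞ := ENNReal.ne_top_of_tsum_ne_top hk i
  refine absurd h (not_le.2 (ENNReal.tsum_lt_tsum hb (fun j => by gcongr; exact hab j) (i := i) ?_))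
  exact (ENNReal.mul_lt_mul_iff_right hi hki).2 (not_le.1 hlt)

/-- Maximum principle: an average of numbers at most `1` reaches `1` only if they all do where the
weight is nonzero. -/
theorem eq_one_of_tsum_mul_eq_one {k a : S → ℝ≥0∞} (hk : ∑' i, k i = 1) (ha : ∀ i, a i ≤ 1)
    (h : ∑' i, k i * a i = 1) {i : S} (hi : k i ≠ 0) : a i = 1 := by
  refine le_antisymm (ha i) ?_
  refine le_of_tsum_mul_le (k := k) (a := fun _ => 1) (b := a) (by simp [hk]) (by simp [h]) ha
    (by simp [hk, h]) hi

open Classical in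
/-- The probability to be at `z` at time `t`, without having returned to the starting point `x`
at the times `1, …, t`. -/
noncomputable def taboo (K : S → S → ℝ≥0∞) (x : S) : ℕ → S → ℝ≥0∞
  | 0 => fun z => if z = x then 1 else 0
  | t + 1 => fun z => if z = x then 0 else ∑' y, taboo K x t y * K y z

/-- The mean number of visits before the first return to the starting point `x`. -/
noncomputable def excursion (K : S → S → ℝ≥0∞) (x z : S) : ℝ≥0∞ := ∑' t, taboo K x t z

open Classical in
/-- The probability to visit `x` at time `t + 1` for the first time after time `0`. -/
noncomputable def firstPassage (K : S → S → ℝ≥0∞) (x : S) : ℕ → S → ℝ≥0∞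
  | 0 => fun y => K y x
  | t + 1 => fun y => ∑' z, K y z * if z = x then 0 else firstPassage K x t z

/-- The probability to visit `x` at a positive time. -/
noncomputable def passage (K : S → S → ℝ≥0∞) (x y : S) : ℝ≥0∞ := ∑' t, firstPassage K x t y

/-- Every set of states that is closed under transitions and nonempty is everything. -/
def Communicates (K : S → S → ℝ≥0∞) : Prop :=
  ∀ (C : S → Prop) (x : S), C x → (∀ y z, C y → K y z ≠ 0 → C z) → ∀ y, C y

variable {K : S → S → ℝ≥0∞}

theorem excursion_self (x : S) : excursion K x x = 1 := by
  unfold excursion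
  rw [tsum_eq_single 0]
  · simp [taboo]
  · intro t ht
    obtain ⟨s, rfl⟩ := Nat.exists_eq_succ_of_ne_zero ht
    simp [taboo]

theorem excursion_of_ne {x z : S} (hz : z ≠ x) :
    excursion K x z = ∑' y, excursion K x y * K y z := by
  unfold excursion
  simp_rw [← ENNReal.tsum_mul_right]
  rw [ENNReal.tsum_comm, tsum_eq_zero_add' ENNReal.summable]
  simp [taboo, hz]

/-- Subinvariance of counting measure gives the bound by induction on the horizon, since away from
`x` the truncated sums satisfy the one-step recursion. -/
theorem sum_taboo_le_one (hcol : ∀ z, ∑' y, K y z ≤ 1) (x : S) (T : ℕ) (z : S) :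
    ∑ t ∈ Finset.range T, taboo K x t z ≤ 1 := by
  induction T generalizing z with
  | zero => simp
  | succ T ih =>
    rw [Finset.sum_range_succ']
    by_cases hz : z = x
    · simp [taboo, hz]
    · simp only [taboo, hz, if_false, add_zero]
      rw [← Summable.tsum_finsetSum (fun _ _ => ENNReal.summable)]
      refine le_trans (ENNReal.tsum_le_tsum fun y => ?_) (hcol z)
      rw [← Finset.sum_mul]
      exact mul_le_of_le_one_left' (ih y)

theorem excursion_le_one (hcol : ∀ z, ∑' y, K y z ≤ 1) (x z : S) : excursion K x z ≤ 1 := by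
  unfold excursion
  rw [ENNReal.tsum_eq_iSup_nat]
  exact iSup_le fun T => sum_taboo_le_one hcol x T z

/-- A first return at time `t + s + 1` is cut according to its position at time `t`. -/
theorem tsum_taboo_mul_firstPassage (x : S) (t s : ℕ) :
    ∑' z, taboo K x t z * firstPassage K x s z = firstPassage K x (t + s) x := by
  classical
  induction t generalizing s with
  | zero =>
    rw [tsum_eq_single x]
    · simp [taboo]
    · intro z hz
      simp [taboo, hz]
  | succ t ih =>
    rw [show t + 1 + s = t + (s + 1) by ring, ← ih]
    simp only [firstPassage, taboo, ← ENNReal.tsum_mul_left]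
    rw [ENNReal.tsum_comm]
    refine tsum_congr fun z => ?_
    by_cases hz : z = x
    · simp [hz]
    · simp only [hz, if_false, ← ENNReal.tsum_mul_right, mul_assoc]

/-- The return probability in terms of the excursion measure. -/
theorem tsum_excursion_mul (x : S) : ∑' z, excursion K x z * K z x = passage K x x := by
  unfold excursion passage
  simp_rw [← ENNReal.tsum_mul_right]
  rw [ENNReal.tsum_comm]
  exact tsum_congr fun t => tsum_taboo_mul_firstPassage x t 0

open Classical in
-- First-step decomposition.
theorem passage_eq (x y : S) :
    passage K x y = ∑' z, K y z * if z = x then 1 else passage K x z := by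
  have h : ∀ z, (K y z * if z = x then 1 else passage K x z) =
      (if z = x then K y z else 0) + K y z * if z = x then 0 else passage K x z := by
    intro z
    split_ifs <;> simp
  simp_rw [h]
  rw [ENNReal.tsum_add, tsum_ite_eq]
  unfold passage
  rw [tsum_eq_zero_add' ENNReal.summable]
  congr 1
  simp only [firstPassage]
  rw [ENNReal.tsum_comm]
  refine tsum_congr fun z => ?_
  rw [ENNReal.tsum_mul_left]
  split_ifs <;> simp

open Classical in
/-- A superharmonic function is at least its value at `x` times the passage probability. -/
theorem passage_mul_le {φ : S → ℝ≥0∞} (hφ : ∀ y, ∑' z, K y z * φ z ≤ φ y) (x y : S) :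
    passage K x y * φ x ≤ φ y := by
  unfold passage
  rw [ENNReal.tsum_eq_iSup_nat, ENNReal.iSup_mul]
  refine iSup_le fun T => ?_
  induction T generalizing y with
  | zero => simp
  | succ T ih =>
    refine le_trans ?_ (hφ y)
    rw [Finset.sum_range_succ']
    simp only [firstPassage]
    rw [← Summable.tsum_finsetSum (fun _ _ => ENNReal.summable), add_mul,
      ← ENNReal.tsum_mul_right, ← tsum_ite_eq x (fun z => K y z * φ z), ← ENNReal.tsum_add]
    refine ENNReal.tsum_le_tsum fun z => ?_
    by_cases hz : z = x
    · simp [hz]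
    · simp only [hz, if_false, add_zero]
      rw [← Finset.mul_sum, mul_assoc]
      gcongr
      exact ih z

theorem passage_le_one (hrow : ∀ y, ∑' z, K y z = 1) (x y : S) : passage K x y ≤ 1 := by
  simpa using passage_mul_le (φ := fun _ => 1) (fun y => by simp [hrow]) x y

/-- Recurrence of one state implies recurrence of all states. -/
theorem passage_self_eq_one (hrow : ∀ y, ∑' z, K y z = 1) (hK : Communicates K) {o : S}
    (ho : passage K o o = 1) (x : S) : passage K x x = 1 := by
  classical
  -- Certainty of reaching `o` propagates along transitions by the maximum principle.
  have hto : ∀ y, passage K o y = 1 := by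
    refine hK (fun y => passage K o y = 1) o ho fun y z hy hyz => ?_
    have := passage_eq (K := K) o y
    rw [hy] at this
    have h1 := eq_one_of_tsum_mul_eq_one (hrow y)
      (fun z => by split_ifs; exacts [le_rfl, passage_le_one hrow o z]) this.symm hyz
    by_cases hz : z = o
    · rw [hz, ho]
    · simpa [hz] using h1
  -- Probability of visiting `x` with time `0` included. It is superharmonic and, as `o` is surely
  -- reached, minimal at `o`; the minimum principle makes it constant.
  set φ : S → ℝ≥0∞ := fun z => if z = x then 1 else passage K x z with hφdef
  have hφx : φ x = 1 := by simp [hφdef]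
  have hφ1 : ∀ z, φ z ≤ 1 := fun z => by
    simp only [hφdef]; split_ifs; exacts [le_rfl, passage_le_one hrow x z]
  have hφ : ∀ y, ∑' z, K y z * φ z ≤ φ y := fun y => by
    rw [← passage_eq]
    simp only [hφdef]; split_ifs; exacts [passage_le_one hrow x y, le_rfl]
  have hmin : ∀ y, φ o ≤ φ y := fun y => by simpa [hto] using passage_mul_le hφ o y
  have hconst : ∀ y, φ y = φ o := by
    refine hK (fun y => φ y = φ o) o rfl fun y z hy hyz => le_antisymm ?_ (hmin z)
    refine le_of_tsum_mul_le (k := K y) (a := φ) (b := fun _ => φ o) (by simp [hrow]) ?_ hmin ?_ hyz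
    · rw [ENNReal.tsum_mul_right, hrow, one_mul]
      exact ((hφ1 o).trans_lt ENNReal.one_lt_top).ne
    · rw [ENNReal.tsum_mul_right, hrow, one_mul, ← hy]
      exact hφ y
  rw [passage_eq]
  change ∑' z, K x z * φ z = 1
  simp_rw [hconst, ← hconst x, hφx]
  simp [hrow]

/-- If the chain is recurrent and the counting measure is invariant, it is the excursion
measure. -/
theorem excursion_eq_one (hcol : ∀ z, ∑' y, K y z = 1) (hK : Communicates K) {x : S}
    (hx : passage K x x = 1) (z : S) : excursion K x z = 1 := by
  have hinv : ∀ z, ∑' y, K y z * excursion K x y = excursion K x z := fun z => by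
    simp_rw [mul_comm (K _ z)]
    by_cases hz : z = x
    · rw [hz, tsum_excursion_mul, hx, excursion_self]
    · exact (excursion_of_ne hz).symm
  by_contra hne
  -- The value `1` propagates backwards along transitions, so the set where it fails is closed
  -- forwards; if nonempty it would contain `x`.
  refine absurd (excursion_self (K := K) x) (hK (fun z => excursion K x z ≠ 1) z hne
    (fun y z hy hyz hz => hy ?_) x)
  exact eq_one_of_tsum_mul_eq_one (hcol z) (excursion_le_one (fun z => (hcol z).le) x)
    ((hinv z).trans hz) hyz

end Kernel

/-! ### Carries of the adding machine in terms of divisibility -/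

section Arithmetic

variable {d : ℕ}

theorem pow_succ_dvd_iff (hd : 2 ≤ d) (n k : ℕ) :
    d ^ (k + 1) ∣ n + 1 ↔ d ^ k ∣ n + 1 ∧ digit d n k = d - 1 := by
  have hpos : 0 < d ^ k := by positivity
  constructor
  · rintro ⟨c, hc⟩
    have hc0 : c ≠ 0 := by rintro rfl; simp at hc
    obtain ⟨e, rfl⟩ := Nat.exists_eq_succ_of_ne_zero hc0
    refine ⟨⟨d * (e + 1), by rw [hc, pow_succ, mul_assoc]⟩, ?_⟩
    have : n = d ^ k * (d * e + (d - 1)) + (d ^ k - 1) := by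
      obtain ⟨f, rfl⟩ : ∃ f, d = f + 1 := ⟨d - 1, by omega⟩
      obtain ⟨g, hg⟩ : ∃ g, (f + 1) ^ k = g + 1 := ⟨(f + 1) ^ k - 1, by omega⟩
      rw [pow_succ, hg] at hc
      rw [hg]
      simp only [Nat.add_sub_cancel, Nat.succ_eq_add_one] at hc ⊢
      have : n + 1 = (g + 1) * ((f + 1) * e + f) + g + 1 := by rw [hc]; ring
      omega
    unfold digit
    rw [this, Nat.mul_add_div hpos, Nat.div_eq_of_lt (by omega), add_zero, Nat.mul_add_mod,
      Nat.mod_eq_of_lt (by omega)]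
  · rintro ⟨⟨c, hc⟩, h⟩
    have hc0 : c ≠ 0 := by rintro rfl; simp at hc
    obtain ⟨e, rfl⟩ := Nat.exists_eq_succ_of_ne_zero hc0
    have : n = d ^ k * e + (d ^ k - 1) := by
      rw [Nat.succ_eq_add_one, mul_add] at hc
      omega
    unfold digit at h
    rw [this, Nat.mul_add_div hpos, Nat.div_eq_of_lt (by omega), add_zero] at h
    rw [hc, pow_succ]
    refine mul_dvd_mul_left _ ⟨e / d + 1, ?_⟩
    have := Nat.div_add_mod e d
    rw [h] at this
    rw [mul_add, Nat.succ_eq_add_one]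
    omega

theorem pow_dvd_iff (hd : 2 ≤ d) (n k : ℕ) :
    d ^ k ∣ n + 1 ↔ ∀ j < k, digit d n j = d - 1 := by
  induction k with
  | zero => simp
  | succ k ih => rw [pow_succ_dvd_iff hd, ih, Nat.forall_lt_succ_right]

/-- Step `k` can be reached only if the `k` lower digits are all `d - 1`. Divisibility replaces
digits from here on. -/
theorem lt_counter_iff (hd : 2 ≤ d) (n k : ℕ) : k < counter d n ↔ d ^ k ∣ n + 1 := by
  have hne : {j | digit d n j ≠ d - 1}.Nonempty := by
    -- As `n < d ^ n`, the digit at place `n` is `0`, which differs from `d - 1`.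
    refine ⟨n, ?_⟩
    simp only [Set.mem_ofPred_eq, digit]
    rw [Nat.div_eq_of_lt (Nat.lt_pow_self (by omega))]
    simp only [Nat.zero_mod]
    omega
  rw [pow_dvd_iff hd, counter, Nat.lt_succ_iff, le_csInf_iff' hne]
  constructor
  · intro h j hj
    by_contra hne
    exact absurd (h hne) (by omega)
  · intro h j hj
    by_contra! hlt
    exact hj (h j hlt)

/-- The `k` steps turn trailing digits `d - 1` into `0`, a loss of `d ^ k - 1`. -/
theorem afterSteps_add_of_dvd (hd : 2 ≤ d) (n k : ℕ) (h : d ^ k ∣ n + 1) :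
    afterSteps d n k + d ^ k = n + 1 := by
  induction k with
  | zero => simp [afterSteps]
  | succ k ih =>
    obtain ⟨hk, hdig⟩ := (pow_succ_dvd_iff hd n k).1 h
    have ih := ih hk
    have hpos : 0 < d ^ k := by positivity
    have hdig' : digit d (afterSteps d n k) k = d - 1 := by
      obtain ⟨c, hc⟩ := h
      have hc0 : c ≠ 0 := by rintro rfl; simp at hc
      obtain ⟨e, rfl⟩ := Nat.exists_eq_succ_of_ne_zero hc0
      have : afterSteps d n k = d ^ k * (d * e + (d - 1)) := by
        obtain ⟨f, rfl⟩ : ∃ f, d = f + 1 := ⟨d - 1, by omega⟩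
        have : afterSteps (f + 1) n k + (f + 1) ^ k
            = (f + 1) ^ k * ((f + 1) * e + f) + (f + 1) ^ k := by
          rw [ih, hc, Nat.succ_eq_add_one]; ring
        simpa using this
      rw [this, digit, Nat.mul_div_cancel_left _ hpos, Nat.mul_add_mod, Nat.mod_eq_of_lt (by omega)]
    have hle : d ^ (k + 1) ≤ n + 1 := Nat.le_of_dvd (by omega) h
    have hmul : (d - 1) * d ^ k + d ^ k = d ^ (k + 1) := by
      rw [pow_succ, ← Nat.succ_mul, mul_comm]
      congr 1
      omega
    rw [afterSteps, addOneAt, if_pos hdig']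
    omega

/-- The last step meets a digit other than `d - 1`, so it adds back the `d ^ k` still missing. -/
theorem afterSteps_counter (hd : 2 ≤ d) (n : ℕ) : afterSteps d n (counter d n) = n + 1 := by
  obtain ⟨k, hk⟩ : ∃ k, counter d n = k + 1 := ⟨_, rfl⟩
  have hdvd : d ^ k ∣ n + 1 := (lt_counter_iff hd n k).1 (by omega)
  have hndvd : ¬ d ^ (k + 1) ∣ n + 1 := fun h => by
    have := (lt_counter_iff hd n (k + 1)).2 h
    omega
  have hadd := afterSteps_add_of_dvd hd n k hdvd
  have hpos : 0 < d ^ k := by positivity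
  have hdig : digit d (afterSteps d n k) k ≠ d - 1 := by
    intro h
    refine hndvd ?_
    obtain ⟨c, hc⟩ := hdvd
    have hc0 : c ≠ 0 := by rintro rfl; simp at hc
    obtain ⟨e, rfl⟩ := Nat.exists_eq_succ_of_ne_zero hc0
    have he : afterSteps d n k = d ^ k * e := by
      rw [hc, Nat.succ_eq_add_one, mul_add] at hadd
      omega
    rw [he, digit, Nat.mul_div_cancel_left _ hpos] at h
    rw [hc, pow_succ]
    refine mul_dvd_mul_left _ ⟨e / d + 1, ?_⟩
    have := Nat.div_add_mod e d
    rw [h] at this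
    rw [mul_add, Nat.succ_eq_add_one]
    omega
  rw [hk, afterSteps, addOneAt, if_neg hdig, hadd]

end Arithmetic

/-! ### Column sums of the transition matrix and recurrence of state `0` -/

section Transition

/-- The transition probabilities of the adding machine with fallible counter, if the first `k`
steps succeed with probability `q k`. -/
noncomputable def transition (d : ℕ) (q : ℕ → ℝ≥0∞) (n m : ℕ) : ℝ≥0∞ :=
  (∑' k, if d ^ k ∣ n + 1 ∧ m + d ^ k = n + 1 then q k - q (k + 1) else 0) +
    if m = n + 1 then q (counter d n) else 0

variable {d : ℕ} {q : ℕ → ℝ≥0∞}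

theorem transition_eq_zero {n m : ℕ} (h : n + 1 < m) : transition d q n m = 0 := by
  have : ∀ k, ¬ (d ^ k ∣ n + 1 ∧ m + d ^ k = n + 1) := fun k hk => by omega
  simp only [transition, this, if_false, tsum_zero, h.ne', add_zero]

theorem transition_succ (hd : 2 ≤ d) (n : ℕ) :
    transition d q n (n + 1) = q (counter d n) := by
  have : ∀ k, ¬ (d ^ k ∣ n + 1 ∧ n + 1 + d ^ k = n + 1) := fun k hk => by
    have : 0 < d ^ k := by positivity
    omega
  simp only [transition, this, if_false, tsum_zero, if_true, zero_add]

theorem transition_pow_le (hd : 2 ≤ d) (hq : Antitone q) {n k : ℕ} (hn : n + 1 = d ^ k) :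
    transition d q n (n + 1) ≤ q k := by
  rw [transition_succ hd]
  exact hq ((lt_counter_iff hd n k).2 (by rw [hn])).le

theorem sum_range_sub (hq : Antitone q) (N : ℕ) :
    ∑ k ∈ Finset.range N, (q k - q (k + 1)) + q N = q 0 := by
  induction N with
  | zero => simp
  | succ N ih =>
    rw [Finset.sum_range_succ, add_assoc, tsub_add_cancel_of_le (hq N.le_succ), ih]

/-- For each `k`, only `n = m + d ^ k - 1` can lead to `m` by a failure at step `k`, and then `d ^ k
∣ n + 1` amounts to `d ^ k ∣ m`. -/
theorem tsum_transition_left (hd : 2 ≤ d) (m : ℕ) :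
    ∑' n, transition d q n m = (∑' k, if d ^ k ∣ m then q k - q (k + 1) else 0) +
      ∑' n, if m = n + 1 then q (counter d n) else 0 := by
  unfold transition
  rw [ENNReal.tsum_add, ENNReal.tsum_comm]
  congr 1
  refine tsum_congr fun k => ?_
  have hpos : 0 < d ^ k := by positivity
  rw [tsum_eq_single (m + d ^ k - 1)]
  · have h : m + d ^ k - 1 + 1 = m + d ^ k := by omega
    simp [h]
  · intro n hn
    rw [if_neg]
    omega

/-- With `m = n + 1`, the powers dividing `m` are those below `counter d n`. The failures telescope
to `1 - q (counter d n)`, and the successful passage from `n` supplies the rest. -/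
theorem tsum_transition_left_of_ne_zero (hd : 2 ≤ d) (hq : Antitone q) (h0 : q 0 = 1) {m : ℕ}
    (hm : m ≠ 0) : ∑' n, transition d q n m = 1 := by
  obtain ⟨n, rfl⟩ := Nat.exists_eq_succ_of_ne_zero hm
  have hlast : ∑' k, (if n + 1 = k + 1 then q (counter d k) else 0) = q (counter d n) := by
    rw [tsum_eq_single n fun k hk => if_neg (by omega), if_pos rfl]
  rw [tsum_transition_left hd, Nat.succ_eq_add_one, hlast, ← h0, ← sum_range_sub hq (counter d n)]
  congr 1
  rw [tsum_eq_sum (s := Finset.range (counter d n))]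
  · refine Finset.sum_congr rfl fun k hk => ?_
    rw [if_pos ((lt_counter_iff hd n k).1 (Finset.mem_range.1 hk))]
  · intro k hk
    rw [if_neg]
    rwa [← lt_counter_iff hd, ← Finset.mem_range]

theorem tsum_transition_left_zero (hd : 2 ≤ d) :
    ∑' n, transition d q n 0 = ∑' k, (q k - q (k + 1)) := by
  simp [tsum_transition_left hd]

/-- The total mass of the increments of `q` is `1` minus the limit of `q`. -/
theorem tsum_sub_add (hq : Antitone q) (h0 : q 0 = 1) {L : ℝ≥0∞} (hL : Tendsto q atTop (𝓝 L)) :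
    ∑' k, (q k - q (k + 1)) + L = 1 := by
  have h := (ENNReal.tendsto_nat_tsum fun k => q k - q (k + 1)).add hL
  simp_rw [sum_range_sub hq, h0] at h
  exact tendsto_nhds_unique h tendsto_const_nhds

theorem tsum_transition_left_le_one (hd : 2 ≤ d) (hq : Antitone q) (h0 : q 0 = 1) (m : ℕ) :
    ∑' n, transition d q n m ≤ 1 := by
  rcases eq_or_ne m 0 with rfl | hm
  · rw [tsum_transition_left_zero hd, ← tsum_sub_add hq h0 (tendsto_atTop_iInf hq)]
    exact le_self_add
  · exact (tsum_transition_left_of_ne_zero hd hq h0 hm).le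

/-- If the product of the success probabilities is positive, the chain may fail to return
to `0`. -/
theorem passage_zero_lt_one (hd : 2 ≤ d) (hq : Antitone q) (h0 : q 0 = 1) {L : ℝ≥0∞}
    (hL : Tendsto q atTop (𝓝 L)) (hL0 : L ≠ 0) : passage (transition d q) 0 0 < 1 := by
  have hsum := tsum_sub_add hq h0 hL
  calc passage (transition d q) 0 0
      = ∑' n, excursion (transition d q) 0 n * transition d q n 0 := (tsum_excursion_mul 0).symm
    _ ≤ ∑' n, transition d q n 0 := ENNReal.tsum_le_tsum fun n =>
        mul_le_of_le_one_left' (excursion_le_one (tsum_transition_left_le_one hd hq h0) 0 n)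
    _ = ∑' k, (q k - q (k + 1)) := tsum_transition_left_zero hd
    _ < ∑' k, (q k - q (k + 1)) + L := ENNReal.lt_add_right
        (ne_top_of_le_ne_top ENNReal.one_ne_top (hsum ▸ le_self_add)) hL0
    _ = 1 := hsum

/-- Before returning to `0`, the chain reaches `d ^ k` with probability at most `q k`. -/
theorem one_le_passage_zero_add (hd : 2 ≤ d) (hq : Antitone q) (h0 : q 0 = 1)
    (hrow : ∀ n, ∑' m, transition d q n m = 1) (k : ℕ) :
    1 ≤ passage (transition d q) 0 0 + q k := by
  set K := transition d q with hK
  set G := excursion K 0 with hG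
  have hG1 : ∀ n, G n ≤ 1 := excursion_le_one (tsum_transition_left_le_one hd hq h0) 0
  obtain ⟨M, hM⟩ : ∃ M, M + 1 = d ^ k := ⟨d ^ k - 1, Nat.sub_add_cancel (Nat.one_le_pow _ _ (by omega))⟩
  -- Jumps up have size one, so only `M` can leave the block `{0, …, M}`.
  have hmass : ∀ n ∈ Finset.range (M + 1),
      1 ≤ ∑ m ∈ Finset.range (M + 1), K n m + if n = M then q k else 0 := by
    intro n hn
    rw [Finset.mem_range] at hn
    rw [← hrow n]
    split_ifs with h
    · rw [tsum_eq_sum (s := Finset.range (M + 1 + 1)), Finset.sum_range_succ]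
      · gcongr
        rw [h]
        exact transition_pow_le hd hq hM
      · intro m hm
        rw [Finset.mem_range] at hm
        exact transition_eq_zero (by omega)
    · rw [add_zero, tsum_eq_sum (s := Finset.range (M + 1))]
      intro m hm
      rw [Finset.mem_range] at hm
      exact transition_eq_zero (by omega)
  -- Mass balance over the block: what is present is sent to nonzero states of the block, to `0`, or
  -- out through `M`. The finite common sum then cancels.
  have hbal : ∑ m ∈ Finset.range M, G (m + 1) + 1 ≤
      ∑ m ∈ Finset.range M, G (m + 1) + (passage K 0 0 + q k) := by
    calc ∑ m ∈ Finset.range M, G (m + 1) + 1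
        = ∑ n ∈ Finset.range (M + 1), G n := by
          rw [Finset.sum_range_succ', hG, excursion_self]
      _ ≤ ∑ n ∈ Finset.range (M + 1),
            G n * (∑ m ∈ Finset.range (M + 1), K n m + if n = M then q k else 0) :=
          Finset.sum_le_sum fun n hn => le_mul_of_one_le_right' (hmass n hn)
      _ = ∑ m ∈ Finset.range (M + 1), ∑ n ∈ Finset.range (M + 1), G n * K n m + G M * q k := by
          simp_rw [mul_add, Finset.sum_add_distrib, Finset.mul_sum]
          rw [Finset.sum_comm]
          simp
      _ ≤ (∑ m ∈ Finset.range M, G (m + 1) + passage K 0 0) + q k := by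
          rw [Finset.sum_range_succ']
          gcongr with m hm
          · rw [hG, excursion_of_ne m.succ_ne_zero]
            exact ENNReal.sum_le_tsum _
          · rw [← tsum_excursion_mul]
            exact ENNReal.sum_le_tsum _
          · exact mul_le_of_le_one_left' (hG1 M)
      _ = _ := add_assoc _ _ _
  refine (ENNReal.add_le_add_iff_left ?_).1 hbal
  exact ENNReal.sum_ne_top.2 fun n _ => ((hG1 _).trans_lt ENNReal.one_lt_top).ne

theorem passage_zero_eq_one (hd : 2 ≤ d) (hq : Antitone q) (h0 : q 0 = 1)
    (hrow : ∀ n, ∑' m, transition d q n m = 1) (hL : Tendsto q atTop (𝓝 0)) :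
    passage (transition d q) 0 0 = 1 := by
  refine le_antisymm (passage_le_one hrow 0 0) ?_
  have h := hL.const_add (passage (transition d q) 0 0)
  rw [add_zero] at h
  exact ge_of_tendsto' h fun k => one_le_passage_zero_add hd hq h0 hrow k

end Transition

/-! ### Law of one transition -/

section Law

theorem stepsDone_eq_iff {d n k : ℕ} {b : ℕ → Bool} :
    stepsDone d n b = k ↔ (k < counter d n ∧ (∀ j < k, b j = true) ∧ b k = false) ∨
      (k = counter d n ∧ ∀ j < k, b j = true) := by
  have hne : {k | k = counter d n ∨ b k = false}.Nonempty := ⟨_, Or.inl rfl⟩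
  constructor
  · rintro rfl
    have hle : stepsDone d n b ≤ counter d n := Nat.sInf_le (Or.inl rfl)
    have hbefore : ∀ j < stepsDone d n b, b j = true := fun j hj => by
      have := Nat.notMem_of_lt_sInf hj
      simp only [Set.mem_ofPred_eq, not_or, Bool.not_eq_false] at this
      exact this.2
    rcases hle.lt_or_eq with h | h
    · exact Or.inl ⟨h, hbefore, (Nat.sInf_mem hne).resolve_left h.ne⟩
    · exact Or.inr ⟨h, hbefore⟩
  · intro h
    refine le_antisymm (Nat.sInf_le ?_) (le_csInf hne ?_)
    · rcases h with h | h
      · exact Or.inr h.2.2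
      · exact Or.inl h.1
    · intro j hj
      by_contra! hlt
      have hjt : b j = true := by
        rcases h with h | h
        · exact h.2.1 j hlt
        · exact h.2 j hlt
      rcases hj with hj | hj
      · rcases h with h | h <;> omega
      · simp [hjt] at hj

theorem measurable_stepsDone (d n : ℕ) : Measurable (stepsDone d n) := by
  refine measurable_to_countable' fun k => ?_
  have h : stepsDone d n ⁻¹' {k} = {b | (k < counter d n ∧ (∀ j < k, b j = true) ∧ b k = false) ∨
      (k = counter d n ∧ ∀ j < k, b j = true)} := by
    ext b
    exact stepsDone_eq_iff
  rw [h]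
  measurability

theorem measurable_outcome (d n : ℕ) : Measurable (outcome d n) :=
  (measurable_of_countable (afterSteps d n)).comp (measurable_stepsDone d n)

variable {Ω : Type*} [MeasurableSpace Ω] {P : Measure Ω} {d : ℕ} {q : ℕ → ℝ≥0∞}
  {η : ℕ → Ω → Bool}

theorem measurableSet_forall_lt (hη : ∀ j, Measurable (η j)) (k : ℕ) :
    MeasurableSet {ω | ∀ j < k, η j ω = true} := by
  measurability

theorem measure_stepsDone_eq [IsFiniteMeasure P] (hd : 2 ≤ d) (hη : ∀ j, Measurable (η j))
    (hq : ∀ k, P {ω | ∀ j < k, η j ω = true} = q k) (n k : ℕ) :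
    P {ω | stepsDone d n (fun j => η j ω) = k} =
      (if d ^ k ∣ n + 1 then q k - q (k + 1) else 0) +
        if k = counter d n then q (counter d n) else 0 := by
  simp_rw [stepsDone_eq_iff, ← lt_counter_iff hd]
  rcases lt_trichotomy k (counter d n) with h | h | h
  · simp only [h, h.ne, if_true, if_false, true_and, false_and, or_false, add_zero]
    rw [← hq k, ← hq (k + 1), ← measure_sdiff]
    · congr 1
      ext ω
      simp only [Set.mem_ofPred_eq, Set.mem_sdiff, Nat.forall_lt_succ_right, not_and,
        Bool.not_eq_true]
      tauto
    · intro ω hω j hj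
      exact hω j (hj.trans k.lt_succ_self)
    · exact (measurableSet_forall_lt hη _).nullMeasurableSet
    · exact measure_ne_top _ _
  · subst h
    simp [hq]
  · simp [h.not_gt, h.ne']

theorem measure_outcome_eq [IsFiniteMeasure P] (hd : 2 ≤ d) (hη : ∀ j, Measurable (η j))
    (hq : ∀ k, P {ω | ∀ j < k, η j ω = true} = q k) (n m : ℕ) :
    P {ω | outcome d n (fun j => η j ω) = m} = transition d q n m := by
  have hmeas : ∀ k, MeasurableSet {ω | stepsDone d n (fun j => η j ω) = k} := fun k =>
    (measurable_stepsDone d n).comp (measurable_pi_lambda _ hη) (measurableSet_singleton k)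
  have hunion : {ω | outcome d n (fun j => η j ω) = m} =
      ⋃ k, {ω | stepsDone d n (fun j => η j ω) = k ∧ afterSteps d n k = m} := by
    ext ω
    simp [outcome]
  rw [hunion, measure_iUnion]
  -- Given the number of steps done, the outcome is deterministic.
  · have hterm : ∀ k, P {ω | stepsDone d n (fun j => η j ω) = k ∧ afterSteps d n k = m} =
        (if d ^ k ∣ n + 1 ∧ m + d ^ k = n + 1 then q k - q (k + 1) else 0) +
          if k = counter d n then (if m = n + 1 then q (counter d n) else 0) else 0 := by
      intro k
      have h1 : d ^ k ∣ n + 1 → (afterSteps d n k = m ↔ m + d ^ k = n + 1) := fun h => by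
        have := afterSteps_add_of_dvd hd n k h
        omega
      have h2 : k = counter d n → (afterSteps d n k = m ↔ m = n + 1) := fun h => by
        rw [h, afterSteps_counter hd, eq_comm]
      by_cases hm : afterSteps d n k = m
      · simp only [hm, and_true, measure_stepsDone_eq hd hη hq]
        congr 1
        · by_cases h : d ^ k ∣ n + 1
          · simp [h, (h1 h).1 hm]
          · simp [h]
        · by_cases h : k = counter d n
          · simp [h, (h2 h).1 hm]
          · simp [h]
      · simp only [hm, and_false, Set.ofPred_false, measure_empty]
        have e1 : ¬ (d ^ k ∣ n + 1 ∧ m + d ^ k = n + 1) := fun h => hm ((h1 h.1).2 h.2)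
        rw [if_neg e1]
        by_cases h : k = counter d n
        · rw [if_pos h, if_neg (fun h' => hm ((h2 h).2 h')), add_zero]
        · rw [if_neg h, add_zero]
    simp_rw [hterm]
    rw [ENNReal.tsum_add, tsum_ite_eq]
    rfl
  · intro k l hkl
    exact Set.disjoint_left.2 fun ω hk hl => hkl (hk.1.symm.trans hl.1)
  · intro k
    exact (hmeas k).inter (MeasurableSet.const _)

end Law

/-! ### Markov property and the probabilistic meaning of the kernel quantities -/

section Chain

variable {Ω : Type*} {d : ℕ} {ξ : ℕ → ℕ → Ω → Bool}

/-- The events that depend on the variables used before time `t`. -/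
@[reducible]
def past (ξ : ℕ → ℕ → Ω → Bool) (t : ℕ) : MeasurableSpace Ω :=
  ⨆ i ∈ {i : ℕ × ℕ | i.1 < t}, MeasurableSpace.comap (ξ i.1 i.2) inferInstance

theorem past_mono {s t : ℕ} (h : s ≤ t) : past ξ s ≤ past ξ t :=
  biSup_mono fun _ hi => lt_of_lt_of_le hi h

theorem measurable_chain (d : ℕ) (ξ : ℕ → ℕ → Ω → Bool) (x t : ℕ) :
    Measurable[past ξ t] (chain d ξ x t) := by
  induction t with
  | zero => exact @measurable_const _ _ _ (past ξ 0) x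
  | succ t ih =>
    have hξ : Measurable[past ξ (t + 1)] fun ω => fun j => ξ t j ω := by
      refine @measurable_pi_lambda _ _ _ (past ξ (t + 1)) _ _ fun j => ?_
      refine Measurable.mono (comap_measurable (ξ t j)) ?_ le_rfl
      exact le_iSup₂_of_le (t, j) (Nat.lt_succ_self t) le_rfl
    have hprod : Measurable fun y : ℕ × (ℕ → Bool) => outcome d y.1 y.2 :=
      measurable_from_prod_countable_right fun n => measurable_outcome d n
    exact hprod.comp ((ih.mono (past_mono t.le_succ) le_rfl).prodMk hξ)

/-- The event that the chain started at `x` has not returned to `x` up to time `t`. -/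
def noReturn (d : ℕ) (ξ : ℕ → ℕ → Ω → Bool) (x t : ℕ) : Set Ω :=
  {ω | ∀ s, 1 ≤ s → s ≤ t → chain d ξ x s ω ≠ x}

theorem noReturn_succ_inter {x t z : ℕ} (hz : z ≠ x) :
    noReturn d ξ x (t + 1) ∩ {ω | chain d ξ x (t + 1) ω = z} =
      noReturn d ξ x t ∩ {ω | chain d ξ x (t + 1) ω = z} := by
  ext ω
  simp only [noReturn, Set.mem_inter_iff, Set.mem_ofPred_eq]
  refine and_congr_left fun h => ⟨fun H s h1 h2 => H s h1 (by omega), fun H s h1 h2 => ?_⟩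
  rcases Nat.le_succ_iff.1 h2 with h2 | rfl
  · exact H s h1 h2
  · exact h ▸ hz

/-- The times without return so far are exactly those before the return time, time `0` included. -/
theorem tsum_indicator_noReturn_le (x : ℕ) (ω : Ω) :
    ∑' t, (noReturn d ξ x t).indicator 1 ω ≤ (returnTime (chain d ξ) x ω : ℝ≥0∞) := by
  classical
  by_cases h : ∃ t, 1 ≤ t ∧ chain d ξ x t ω = x
  · have hle : ((Nat.find h : ℕ) : ℕ∞) ≤ returnTime (chain d ξ) x ω :=
      le_iInf₂ fun t ht => Nat.cast_le.2 (Nat.find_min' h ht)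
    refine le_trans ?_ (ENat.toENNReal_le.2 hle)
    rw [tsum_eq_sum (s := Finset.range (Nat.find h))]
    · refine (Finset.sum_le_card_nsmul _ _ 1 fun t _ => Set.indicator_le_self' (by simp) ω).trans ?_
      simp
    · intro t ht
      refine Set.indicator_of_notMem (fun hω => ?_) _
      rw [Finset.mem_range, not_lt] at ht
      exact hω _ (Nat.find_spec h).1 ht (Nat.find_spec h).2
  · have htop : returnTime (chain d ξ) x ω = ⊤ := by
      simp only [returnTime, iInf_eq_top]
      exact fun t ht => absurd ⟨t, ht⟩ h
    simp [htop]

theorem measurableSet_noReturn (d : ℕ) (ξ : ℕ → ℕ → Ω → Bool) (x t : ℕ) :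
    MeasurableSet[past ξ t] (noReturn d ξ x t) := by
  have h : noReturn d ξ x t = ⋂ s ∈ Finset.Icc 1 t, {ω | chain d ξ x s ω = x}ᶜ := by
    ext ω
    simp [noReturn]
  rw [h]
  refine Finset.measurableSet_biInter _ fun s hs => MeasurableSet.compl ?_
  exact past_mono (Finset.mem_Icc.1 hs).2 _ (measurable_chain d ξ x s (measurableSet_singleton x))

variable [mΩ : MeasurableSpace Ω] {P : Measure Ω} {K : ℕ → ℕ → ℝ≥0∞}

theorem past_le (hmeas : ∀ t j, Measurable (ξ t j)) (t : ℕ) : past ξ t ≤ mΩ :=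
  iSup₂_le fun i _ => (hmeas i.1 i.2).comap_le

/-- The Markov property. -/
theorem measure_inter_chain_succ (hmeas : ∀ t j, Measurable (ξ t j))
    (hindep : iIndepFun (fun i : ℕ × ℕ => ξ i.1 i.2) P)
    (hK : ∀ t n m, P {ω | outcome d n (fun j => ξ t j ω) = m} = K n m)
    (x t z : ℕ) {A : Set Ω} (hA : MeasurableSet[past ξ t] A) :
    P (A ∩ {ω | chain d ξ x (t + 1) ω = z}) =
      ∑' y, P (A ∩ {ω | chain d ξ x t ω = y}) * K y z := by
  have hpast : ∀ y, MeasurableSet[past ξ t] (A ∩ {ω | chain d ξ x t ω = y}) := fun y =>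
    hA.inter (measurable_chain d ξ x t (measurableSet_singleton y))
  have hnext : ∀ y, MeasurableSet[⨆ i ∈ {i : ℕ × ℕ | i.1 = t},
      MeasurableSpace.comap (ξ i.1 i.2) inferInstance]
      {ω | outcome d y (fun j => ξ t j ω) = z} := by
    intro y
    refine (measurable_outcome d y).comp (@measurable_pi_lambda _ _ _ (_) _ _ fun j => ?_)
      (measurableSet_singleton z)
    refine Measurable.mono (comap_measurable (ξ t j)) ?_ le_rfl
    exact le_iSup₂_of_le (f := fun (i : ℕ × ℕ) (_ : i ∈ {i : ℕ × ℕ | i.1 = t}) =>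
      MeasurableSpace.comap (ξ i.1 i.2) inferInstance) (t, j) rfl le_rfl
  have hind := indep_iSup_of_disjoint (fun i : ℕ × ℕ => (hmeas i.1 i.2).comap_le) hindep
    (S := {i | i.1 < t}) (T := {i | i.1 = t})
    (Set.disjoint_left.2 fun i (h1 : i.1 < t) (h2 : i.1 = t) => h1.ne h2)
  have hunion : A ∩ {ω | chain d ξ x (t + 1) ω = z} =
      ⋃ y, (A ∩ {ω | chain d ξ x t ω = y}) ∩ {ω | outcome d y (fun j => ξ t j ω) = z} := by
    ext ω
    simp [chain]
  rw [hunion, measure_iUnion]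
  · refine tsum_congr fun y => ?_
    rw [← hK t]
    exact (Indep_iff _ _ _).1 hind _ _ (hpast y) (hnext y)
  · intro y y' hne
    exact Set.disjoint_left.2 fun ω h h' => hne (h.1.2.symm.trans h'.1.2)
  · intro y
    refine ((past_le hmeas t) _ (hpast y)).inter ?_
    exact (measurable_outcome d y).comp (measurable_pi_lambda _ fun j => hmeas t j)
      (measurableSet_singleton z)

theorem measure_noReturn_inter [IsProbabilityMeasure P] (hmeas : ∀ t j, Measurable (ξ t j))
    (hindep : iIndepFun (fun i : ℕ × ℕ => ξ i.1 i.2) P)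
    (hK : ∀ t n m, P {ω | outcome d n (fun j => ξ t j ω) = m} = K n m) (x t z : ℕ) :
    P (noReturn d ξ x t ∩ {ω | chain d ξ x t ω = z}) = taboo K x t z := by
  induction t generalizing z with
  | zero =>
    have h : noReturn d ξ x 0 = Set.univ := by
      ext ω
      simp only [noReturn, Set.mem_ofPred_eq, Set.mem_univ, iff_true]
      intro s h1 h2
      omega
    rw [h, Set.univ_inter]
    by_cases hz : z = x
    · simp [chain, taboo, hz]
    · simp [chain, taboo, hz, Ne.symm hz]
  | succ t ih =>
    by_cases hz : z = x
    · have h : noReturn d ξ x (t + 1) ∩ {ω | chain d ξ x (t + 1) ω = z} = ∅ := by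
        ext ω
        simp only [noReturn, Set.mem_inter_iff, Set.mem_ofPred_eq, Set.mem_empty_iff_false,
          iff_false, not_and]
        intro H h
        exact H (t + 1) (by omega) le_rfl (h.trans hz)
      rw [h, measure_empty]
      simp [taboo, hz]
    · rw [noReturn_succ_inter hz,
        measure_inter_chain_succ hmeas hindep hK x t z (measurableSet_noReturn d ξ x t)]
      simp [ih, taboo, hz]

/-- The return event is split by the time `t + 1` of the first return, and the Markov property is
applied at time `t`. -/
theorem returnProb_eq [IsProbabilityMeasure P] (hmeas : ∀ t j, Measurable (ξ t j))
    (hindep : iIndepFun (fun i : ℕ × ℕ => ξ i.1 i.2) P)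
    (hK : ∀ t n m, P {ω | outcome d n (fun j => ξ t j ω) = m} = K n m) (x : ℕ) :
    returnProb P (chain d ξ) x = passage K x x := by
  have hunion : {ω | ∃ t, 1 ≤ t ∧ chain d ξ x t ω = x} =
      ⋃ t, noReturn d ξ x t ∩ {ω | chain d ξ x (t + 1) ω = x} := by
    ext ω
    simp only [Set.mem_ofPred_eq, Set.mem_iUnion, Set.mem_inter_iff, noReturn]
    constructor
    · intro h
      classical
      obtain ⟨h1, h2⟩ := Nat.find_spec h
      refine ⟨Nat.find h - 1, fun s hs1 hs2 hs => ?_, ?_⟩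
      · exact Nat.find_min h (by omega) ⟨hs1, hs⟩
      · rwa [Nat.sub_add_cancel h1]
    · rintro ⟨t, -, h⟩
      exact ⟨t + 1, by omega, h⟩
  rw [returnProb, hunion, measure_iUnion, ← tsum_excursion_mul]
  · simp_rw [measure_inter_chain_succ hmeas hindep hK x _ x (measurableSet_noReturn d ξ x _),
      measure_noReturn_inter hmeas hindep hK, excursion, ← ENNReal.tsum_mul_right]
    exact ENNReal.tsum_comm
  · have key : ∀ s t, s < t → Disjoint (noReturn d ξ x s ∩ {ω | chain d ξ x (s + 1) ω = x})
        (noReturn d ξ x t ∩ {ω | chain d ξ x (t + 1) ω = x}) := fun s t hst =>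
      Set.disjoint_left.2 fun ω h h' => h'.1 (s + 1) (by omega) hst h.2
    intro s t hst
    rcases lt_or_gt_of_ne hst with h | h
    · exact key s t h
    · exact (key t s h).symm
  · intro t
    exact (past_le hmeas t _ (measurableSet_noReturn d ξ x t)).inter
      (past_le hmeas _ _ (measurable_chain d ξ x (t + 1) (measurableSet_singleton x)))

/-- Tail-sum formula: summing the taboo probabilities over states first gives the probability of no
return up to time `t`. -/
theorem tsum_excursion_le_meanReturnTime [IsProbabilityMeasure P]
    (hmeas : ∀ t j, Measurable (ξ t j)) (hindep : iIndepFun (fun i : ℕ × ℕ => ξ i.1 i.2) P)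
    (hK : ∀ t n m, P {ω | outcome d n (fun j => ξ t j ω) = m} = K n m) (x : ℕ) :
    ∑' z, excursion K x z ≤ meanReturnTime P (chain d ξ) x := by
  have hN : ∀ t, MeasurableSet (noReturn d ξ x t) := fun t =>
    past_le hmeas t _ (measurableSet_noReturn d ξ x t)
  calc ∑' z, excursion K x z = ∑' t, ∑' z, taboo K x t z := ENNReal.tsum_comm
    _ = ∑' t, P (noReturn d ξ x t) := by
        refine tsum_congr fun t => ?_
        simp_rw [← measure_noReturn_inter hmeas hindep hK]
        rw [← measure_iUnion]
        · congr 1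
          ext ω
          simp
        · intro y z hne
          exact Set.disjoint_left.2 fun ω h h' => hne (h.2.symm.trans h'.2)
        · intro z
          exact (hN t).inter
            (past_le hmeas _ _ (measurable_chain d ξ x t (measurableSet_singleton z)))
    _ = ∫⁻ ω, ∑' t, (noReturn d ξ x t).indicator 1 ω ∂P := by
        rw [lintegral_tsum fun t => (measurable_one.indicator (hN t)).aemeasurable]
        exact tsum_congr fun t => (lintegral_indicator_one (hN t)).symm
    _ ≤ meanReturnTime P (chain d ξ) x := lintegral_mono fun ω => tsum_indicator_noReturn_le x ω

theorem communicates_of_isIrreducible [IsProbabilityMeasure P]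
    (hmeas : ∀ t j, Measurable (ξ t j)) (hindep : iIndepFun (fun i : ℕ × ℕ => ξ i.1 i.2) P)
    (hK : ∀ t n m, P {ω | outcome d n (fun j => ξ t j ω) = m} = K n m)
    (hirr : IsIrreducible P (chain d ξ)) : Communicates K := by
  intro C x hx hC
  have key : ∀ t y, P {ω | chain d ξ x t ω = y} ≠ 0 → C y := by
    intro t
    induction t with
    | zero =>
      intro y hy
      by_cases h : x = y
      · exact h ▸ hx
      · simp [chain, h] at hy
    | succ t ih =>
      intro z hz
      have h := measure_inter_chain_succ hmeas hindep hK x t z (A := Set.univ) MeasurableSet.univ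
      simp only [Set.univ_inter] at h
      rw [h, ne_eq, ENNReal.tsum_eq_zero, not_forall] at hz
      obtain ⟨y, hy⟩ := hz
      exact hC y z (ih y (left_ne_zero_of_mul hy)) (right_ne_zero_of_mul hy)
  intro y
  obtain ⟨t, ht⟩ := hirr x y
  exact key t y ht.ne'

theorem measure_forall_lt_eq (p : ℕ → ℝ) (hp : ∀ j, 0 ≤ p j)
    (hlaw : ∀ t j, P {ω | ξ t j ω = true} = ENNReal.ofReal (p j))
    (hindep : iIndepFun (fun i : ℕ × ℕ => ξ i.1 i.2) P) (t k : ℕ) :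
    P {ω | ∀ j < k, ξ t j ω = true} = ENNReal.ofReal (∏ j ∈ Finset.range k, p j) := by
  have hrow : iIndepFun (fun j => ξ t j) P :=
    hindep.precomp (g := fun j => (t, j)) fun i j h => (Prod.mk.inj h).2
  have h := hrow.measure_inter_preimage_eq_mul (Finset.range k) (sets := fun _ => {true})
    fun _ _ => measurableSet_singleton _
  rw [ENNReal.ofReal_prod_of_nonneg fun j _ => hp j]
  simp_rw [← hlaw t]
  refine Eq.trans (congrArg P ?_) h
  ext ω
  simp

end Chain

end AMFC

theorem proposition2p1 {Ω : Type*} [MeasurableSpace Ω] (P : Measure Ω) [IsProbabilityMeasure P]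
    (d : ℕ) (hd : 2 ≤ d)
    (p : ℕ → ℝ) (hp : ∀ j, 0 < p j ∧ p j ≤ 1)
    (ξ : ℕ → ℕ → Ω → Bool) (hmeas : ∀ t j, Measurable (ξ t j))
    (hlaw : ∀ t j, P {ω | ξ t j ω = true} = ENNReal.ofReal (p j))
    (hindep : iIndepFun (fun q : ℕ × ℕ => ξ q.1 q.2) P)
    (hirr : AMFC.IsIrreducible P (AMFC.chain d ξ)) :
    (AMFC.IsNullRecurrent P (AMFC.chain d ξ) ↔ AMFC.ProdEqZero p) ∧
      (¬ AMFC.ProdEqZero p → AMFC.IsTransient P (AMFC.chain d ξ)) ∧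
      ¬ AMFC.IsPositiveRecurrent P (AMFC.chain d ξ) := by
  open AMFC in
  set q : ℕ → ℝ≥0∞ := fun k => ENNReal.ofReal (∏ j ∈ Finset.range k, p j) with hqdef
  have hanti : Antitone q := antitone_nat_of_succ_le fun k => by
    refine ENNReal.ofReal_le_ofReal ?_
    rw [Finset.prod_range_succ]
    exact mul_le_of_le_one_right (Finset.prod_nonneg fun j _ => (hp j).1.le) (hp k).2
  have h0 : q 0 = 1 := by simp [hqdef]
  have hK : ∀ t n m, P {ω | outcome d n (fun j => ξ t j ω) = m} = transition d q n m :=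
    fun t n m => measure_outcome_eq hd (hmeas t)
      (measure_forall_lt_eq p (fun j => (hp j).1.le) hlaw hindep t) n m
  have hrow : ∀ n, ∑' m, transition d q n m = 1 := by
    intro n
    simp_rw [← hK 0]
    rw [← measure_iUnion]
    · rw [← measure_univ (μ := P)]
      congr 1
      ext ω
      simp
    · intro y z hne
      exact Set.disjoint_left.2 fun ω h h' => hne (h.symm.trans h')
    · intro z
      exact (measurable_outcome d n).comp (measurable_pi_lambda _ fun j => hmeas 0 j)
        (measurableSet_singleton z)
  have hcom := communicates_of_isIrreducible hmeas hindep hK hirr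
  have hret := returnProb_eq hmeas hindep hK
  have hprod : ProdEqZero p ↔ Tendsto q atTop (𝓝 0) := by
    rw [ProdEqZero, hqdef]
    constructor
    · intro h
      simpa using ENNReal.tendsto_ofReal h
    · intro h
      refine ((ENNReal.tendsto_toReal ENNReal.zero_ne_top).comp h).congr fun k => ?_
      exact ENNReal.toReal_ofReal (Finset.prod_nonneg fun j _ => (hp j).1.le)
  have htrans : ¬ ProdEqZero p → IsTransient P (chain d ξ) := by
    intro hne x
    rw [hret x]
    refine lt_of_le_of_ne (passage_le_one hrow x x) fun hx => ?_
    -- A recurrent `x` would make `0` recurrent, against the bound by the sum of column `0`.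
    refine (passage_zero_lt_one hd hanti h0 (tendsto_atTop_iInf hanti) fun hL => hne ?_).ne
      (passage_self_eq_one hrow hcom hx 0)
    rw [hprod, ← hL]
    exact tendsto_atTop_iInf hanti
  have hnull : ProdEqZero p → IsNullRecurrent P (chain d ξ) := by
    intro h x
    rw [hprod] at h
    have hx := passage_self_eq_one hrow hcom (passage_zero_eq_one hd hanti h0 hrow h) x
    refine ⟨(hret x).trans hx, top_le_iff.1 ?_⟩
    refine le_trans ?_ (tsum_excursion_le_meanReturnTime hmeas hindep hK x)
    -- The vanishing product fills column `0`, so counting measure is invariant.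
    have hcol : ∀ m, ∑' n, transition d q n m = 1 := by
      intro m
      rcases eq_or_ne m 0 with rfl | hm
      · rw [tsum_transition_left_zero hd]
        simpa using tsum_sub_add hanti h0 h
      · exact tsum_transition_left_of_ne_zero hd hanti h0 hm
    simp_rw [excursion_eq_one hcol hcom hx]
    simp
  refine ⟨⟨fun h => ?_, hnull⟩, htrans, fun h => ?_⟩
  · by_contra hne
    exact (htrans hne 0).ne (h 0).1
  · by_cases hz : ProdEqZero p
    · exact (h 0).2.ne (hnull hz 0).2
    · exact (htrans hz 0).ne (h 0).1
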